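/- **Setting.** For a semilattice $\mathbf A=\langle A,\wedge,1\rangle$ let $\mathcal X(\mathbf A)$ be the set of irreducible filters (proper filters $F$ such that $F=F_1\cap F_2$ with $F_1,F_2$ filters implies $F=F_1$ or $F=F_2$), $\beta(a)=\{P\in\mathcal X(\mathbf A):a\in P\}$ and $\mathcal K_{\mathbf A}=\{\beta(a)^c:a\in A\}$. Let $\mathcal K$ be a family of subsets of $X$, regarded as a subbase of a topology. Put $S(X)=\{U^c:U\in\mathcal K\}$, $\mathcal C_{\mathcal K}(X)=\{\bigcap\mathcal A:\mathcal A\subseteq S(X)\}$, and let $\mathcal Z(X)$ be the family of all $\bigcap\mathcal L$ with $\mathcal L\subseteq\mathcal K$ non-empty and dually directed under $\subseteq$. For $Y\subseteq X$, a $Y$-family is a family $\mathcal J\subseteq S(X)$ such that for all $A,B\in\mathcal J$ there are $H\in S(X)$ and $C\in\mathcal J$ with $Y\subseteq H$, $A\cap H\subseteq C$ and $B\cap H\subseteq C$. The pair $\langle X,\mathcal K\rangle$ is an *S-space* if (S1) it is $T_0$ and $X=\bigcup\mathcal K$; (S2) the members of $\mathcal K$ are compact, $\mathcal K$ is closed under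 finite unions and $\emptyset\in\mathcal K$; (S3) if $x\in U\cap V$ with $U,V\in\mathcal K$, there are $W,D\in\mathcal K$ with $x\notin W$, $x\in D$, $D\subseteq(U\cap V)\cup W$; (S4) if $Y\in\mathcal C_{\mathcal K}(X)$ and $\mathcal J$ is a non-empty $Y$-family with $Y\cap A^c\neq\emptyset$ for all $A\in\mathcal J$, then $Y\cap\bigcap\{A^c:A\in\mathcal J\}\neq\emptyset$. In an S-space, $\mathbf S(X)=\langle S(X),\cap,X\rangle$ is a semilattice and $H_X:X\to\mathcal X(\mathbf S(X))$ is $H_X(x)=\{A\in S(X):x\in A\}$. Write $(x]=\{y\in X: x\in \mathrm{cl}_{\mathcal K}(y)\}$, where $\mathrm{cl}_{\mathcal K}(y)=\bigcap\{U\in S(X):y\in U\}$, and $L_U=\{Z\in\mathcal Z(X):Z\cap U\ne\emptyset\}$. * An *MoS-space* is $\langle X,\mathcal K,T\rangle$ with $\langle X,\mathcal K\rangle$ an S-space and $T\subseteq X\times X$ a meet-relation: $\Box_T(U)=\{x:T(x)\subseteq U\}\in S(X)$ for all $U\in S(X)$, and $T(x)=\bigcap\{U\in S(X):T(x)\subseteq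 U\}$ for all $x$. * An *mS-space* is $\langle X,\mathcal K,R\rangle$ with $\langle X,\mathcal K\rangle$ an S-space and $R\subseteq X\times\mathcal Z(X)$ such that $m_R(U)=\{x:R(x)\subseteq L_U\}\in S(X)$ for all $U\in S(X)$, and $R(x)=\bigcap\{L_U:U\in S(X),\ x\in m_R(U)\}$ for all $x$ (intersection inside $\mathcal Z(X)$). It is *normal* if for all $x$ and all $Z\in R(x)$ there is $z\in Z$ with $(z]\in R(x)$, and $\emptyset\notin R(x)$ for all $x$. * For an MoS-space, $R_T\subseteq X\times\mathcal Z(X)$ is given by $(x,Z)\in R_T\iff (H_X(x),H_X[Z])\in R_{\Box_T}$. Here, for an operation $m$ on $\mathbf A$, the relation $R_m\subseteq\mathcal X(\mathbf A)\times\mathcal Z(\mathcal X(\mathbf A))$ is defined by $(P,Z)\in R_m\iff m^{-1}[P]\cap\{a\in A:\beta(a)\cap Z=\emptyset\}=\emptyset$, and $\mathcal Z(\mathcal X(\mathbf A))$ is taken with respect to $\mathcal K_{\mathbf A}$. * For an mS-space, $T_R\subseteq X\times X$ is given by $(x,y)\in T_R\iff m_R^{-1}[H_X(x)]\subseteq H_X(y)$.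 **Theorem.** Let $\langle X,\mathcal K\rangle$ be an S-space. 1. If $\langle X,\mathcal K,T\rangle$ is an MoS-space, then $\langle X,\mathcal K,R_T\rangle$ is an mS-space, $T=T_{R_T}$ and $m_{R_T}=\Box_T$ on $S(X)$. If moreover $(x]\in\mathcal Z(X)$ for every $x\in X$, then $\langle X,\mathcal K,R_T\rangle$ is normal. 2. If $\langle X,\mathcal K,R\rangle$ is a normal mS-space, then $\langle X,\mathcal K,T_R\rangle$ is an MoS-space, $R=R_{T_R}$ and $m_R=\Box_{T_R}$ on $S(X)$. In particular, when all the sets $(x]$ belong to $\mathcal Z(X)$, the assignments $T\mapsto R_T$ and $R\mapsto T_R$ are mutually inverse bijections between the meet-relations $T$ making $\langle X,\mathcal K,T\rangle$ an MoS-space and the multirelations $R$ making $\langle X,\mathcal K,R\rangle$ a normal mS-space. -/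

import Mathlib

universe u v w

namespace MoS

/-! ### Binary relations and multirelations -/

/-- The section `T(x) = {y : (x, y) ∈ T}` of a binary relation. With `β = Set α` this is also
the section `R(x)` of a multirelation. -/
def sect {α : Type u} {β : Type v} (T : Set (α × β)) (x : α) : Set β := {y | (x, y) ∈ T}

/-- `□_T(U) = {x : T(x) ⊆ U}`. -/
def box {α : Type u} {β : Type v} (T : Set (α × β)) (U : Set β) : Set α := {x | sect T x ⊆ U}

/-! ### Irreducible filters of a semilattice with greatest element -/

section Semilattice

variable {A : Type u} [SemilatticeInf A] [OrderTop A]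

/-- Filters of a meet-semilattice with greatest element. -/
structure IsSemilatticeFilter (F : Set A) : Prop where
  upper : ∀ a b : A, a ≤ b → a ∈ F → b ∈ F
  top_mem : (⊤ : A) ∈ F
  inf_mem : ∀ a b : A, a ∈ F → b ∈ F → a ⊓ b ∈ F

/-- Irreducible filters: proper filters that are not the intersection of two filters different
from them. -/
structure IsIrreducibleFilter (F : Set A) : Prop where
  isFilter : IsSemilatticeFilter F
  proper : F ≠ Set.univ
  irreducible : ∀ F₁ F₂ : Set A, IsSemilatticeFilter F₁ → IsSemilatticeFilter F₂ →
    F = F₁ ∩ F₂ → F = F₁ ∨ F = F₂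

variable (A) in
/-- The set `𝒳(A)` of irreducible filters. -/
abbrev IrrFilter : Type u := {F : Set A // IsIrreducibleFilter F}

/-- `β(a) = {P ∈ 𝒳(A) : a ∈ P}`. -/
def beta (a : A) : Set (IrrFilter A) := {P | a ∈ P.1}

variable (A) in
/-- The subbase `𝒦_A = {β(a)ᶜ : a ∈ A}` of `𝒳(A)`. -/
def specSubbase : Set (Set (IrrFilter A)) := {U | ∃ a : A, U = (beta a)ᶜ}

/-- `I_A(Z) = {a ∈ A : β(a) ∩ Z = ∅}`. -/
def idealOf (Z : Set (IrrFilter A)) : Set A := {a | beta a ∩ Z = ∅}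

/-- `N_h = {(P, Q) ∈ 𝒳(B) × 𝒳(A) : h⁻¹[P] ⊆ Q}`. -/
def relOfMap {B : Type v} [SemilatticeInf B] [OrderTop B] (h : A → B) :
    Set (IrrFilter B × IrrFilter A) :=
  {p | h ⁻¹' p.1.1 ⊆ p.2.1}

end Semilattice

/-! ### Subbasic notions -/

section Subbase

variable {X : Type u} (K : Set (Set X))

/-- `S(X)`, the family of complements of members of the subbase. -/
def subbasicClosed : Set (Set X) := {A | Aᶜ ∈ K}

/-- `C_K(X)`, the family of intersections of subfamilies of `S(X)`. -/
def closureSystem : Set (Set X) := {Y | ∃ 𝒜 : Set (Set X), 𝒜 ⊆ subbasicClosed K ∧ Y = ⋂₀ 𝒜}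

/-- `Y`-families of members of `S(X)`. -/
def IsYFamily (Y : Set X) (J : Set (Set X)) : Prop :=
  J ⊆ subbasicClosed K ∧ ∀ A ∈ J, ∀ B ∈ J,
    ∃ H ∈ subbasicClosed K, ∃ C ∈ J, Y ⊆ H ∧ A ∩ H ⊆ C ∧ B ∩ H ⊆ C

/-- `Z(X)`, the family of subbasic saturated sets: intersections of non-empty dually directed
subfamilies of the subbase. -/
def saturated : Set (Set X) :=
  {Z | ∃ L : Set (Set X), L ⊆ K ∧ L.Nonempty ∧ DirectedOn (fun U V => U ⊇ V) L ∧ Z = ⋂₀ L}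

/-- The closure `cl_K(Y)`. -/
def cl (Y : Set X) : Set X := ⋂₀ {U | U ∈ subbasicClosed K ∧ Y ⊆ U}

/-- The specialization order: `x ⊑ y` if and only if `x ∈ cl_K(y)`. -/
def specLE (x y : X) : Prop := x ∈ cl K {y}

/-- `(x] = {y : y ⊒ x}`. -/
def down (x : X) : Set X := {y | specLE K x y}

/-- `L_U = {Z ∈ Z(X) : Z ∩ U ≠ ∅}`. -/
def meets (U : Set X) : Set (Set X) := {Z | Z ∈ saturated K ∧ (Z ∩ U).Nonempty}

/-- `m_R(U) = {x : R(x) ⊆ L_U}`. -/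
def mSet (R : Set (X × Set X)) (U : Set X) : Set X := {x | sect R x ⊆ meets K U}

end Subbase

/-- For a monotone operation `m` on a semilattice, the multirelation
`R_m ⊆ 𝒳(A) × Z(𝒳(A))` with `(P, Z) ∈ R_m ↔ m⁻¹[P] ∩ I_A(Z) = ∅`. -/
def multiRelOfMap {A : Type u} [SemilatticeInf A] [OrderTop A] (m : A → A) :
    Set (IrrFilter A × Set (IrrFilter A)) :=
  {p | p.2 ∈ saturated (specSubbase A) ∧ m ⁻¹' p.1.1 ∩ idealOf p.2 = ∅}

/-! ### S-spaces -/

/-- An S-space structure on `X`: a subbase `K` satisfying (S1)-(S4), where `T₀` and compactness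
refer to the topology generated by `K`. In (S4) the `Y`-family is non-empty. -/
structure SSpace (X : Type u) where
  K : Set (Set X)
  t0 : @T0Space X (TopologicalSpace.generateFrom K)
  cover : ⋃₀ K = Set.univ
  compact : ∀ U ∈ K, @IsCompact X (TopologicalSpace.generateFrom K) U
  union_mem : ∀ U ∈ K, ∀ V ∈ K, U ∪ V ∈ K
  empty_mem : ∅ ∈ K
  separation : ∀ x : X, ∀ U ∈ K, ∀ V ∈ K, x ∈ U ∩ V →
    ∃ W ∈ K, ∃ D ∈ K, x ∉ W ∧ x ∈ D ∧ D ⊆ (U ∩ V) ∪ W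
  family : ∀ Y ∈ closureSystem K, ∀ J : Set (Set X), J.Nonempty → IsYFamily K Y J →
    (∀ A ∈ J, (Y ∩ Aᶜ).Nonempty) → (Y ∩ ⋂ A ∈ J, Aᶜ).Nonempty

namespace SSpace

variable {X : Type u} (𝕏 : SSpace X)

/-- The semilattice `S(X)`, as a type. -/
def S : Type u := {A : Set X // A ∈ subbasicClosed 𝕏.K}

/-- `S(X)` is ordered by inclusion, with intersection as meet. -/
instance : SemilatticeInf 𝕏.S where
  le U V := U.1 ⊆ V.1
  le_refl U := Set.Subset.refl U.1
  le_trans _ _ _ h k := Set.Subset.trans h k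
  le_antisymm _ _ h k := Subtype.ext (Set.Subset.antisymm h k)
  inf U V := ⟨U.1 ∩ V.1, by
    have := 𝕏.union_mem _ U.2 _ V.2
    simpa only [subbasicClosed, Set.mem_ofPred_eq, Set.compl_inter] using this⟩
  inf_le_left _ _ := Set.inter_subset_left
  inf_le_right _ _ := Set.inter_subset_right
  le_inf _ _ _ h k := Set.subset_inter h k

/-- The greatest element of `S(X)` is `X`. -/
instance : OrderTop 𝕏.S where
  top := ⟨Set.univ, by
    simpa only [subbasicClosed, Set.mem_ofPred_eq, Set.compl_univ] using 𝕏.empty_mem⟩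
  le_top U := Set.subset_univ U.1

theorem isIrreducibleFilter_point (x : X) : IsIrreducibleFilter {U : 𝕏.S | x ∈ U.1} where
  isFilter := ⟨fun _ _ h hx => h hx, Set.mem_univ x, fun _ _ h k => ⟨h, k⟩⟩
  proper := by
    intro h
    obtain ⟨U, hU, hxU⟩ : x ∈ ⋃₀ 𝕏.K := by rw [𝕏.cover]; trivial
    have h1 : (⟨Uᶜ, by simpa [subbasicClosed] using hU⟩ : 𝕏.S) ∈ {U : 𝕏.S | x ∈ U.1} := by
      rw [h]; trivial
    exact h1 hxU
  irreducible := by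
    intro F₁ F₂ h₁ h₂ h
    by_contra hne
    push Not at hne
    have key : ∀ G G' : Set 𝕏.S, {U : 𝕏.S | x ∈ U.1} = G ∩ G' → {U : 𝕏.S | x ∈ U.1} ≠ G →
        ∃ A ∈ G, x ∉ A.1 := by
      intro G G' hG hn
      by_contra hc
      push Not at hc
      exact hn (Set.Subset.antisymm (fun a ha => (hG ▸ ha : a ∈ G ∩ G').1) hc)
    obtain ⟨A, hA, hxA⟩ := key F₁ F₂ h hne.1
    obtain ⟨B, hB, hxB⟩ := key F₂ F₁ (by rw [h, Set.inter_comm]) hne.2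
    obtain ⟨W, hW, D, hD, hxW, hxD, hsub⟩ := 𝕏.separation x _ A.2 _ B.2 ⟨hxA, hxB⟩
    let W' : 𝕏.S := ⟨Wᶜ, by simpa [subbasicClosed] using hW⟩
    let D' : 𝕏.S := ⟨Dᶜ, by simpa [subbasicClosed] using hD⟩
    have hW' : W' ∈ F₁ ∩ F₂ := by rw [← h]; exact hxW
    have hA' : A ⊓ W' ≤ D' := fun y hy hyD =>
      (hsub hyD).elim (fun q => q.1 hy.1) (fun q => hy.2 q)
    have hB' : B ⊓ W' ≤ D' := fun y hy hyD =>
      (hsub hyD).elim (fun q => q.2 hy.1) (fun q => hy.2 q)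
    have hD' : D' ∈ F₁ ∩ F₂ :=
      ⟨h₁.upper _ _ hA' (h₁.inf_mem _ _ hA hW'.1), h₂.upper _ _ hB' (h₂.inf_mem _ _ hB hW'.2)⟩
    rw [← h] at hD'
    exact hD' hxD

/-- `H_X : X → 𝒳(S(X))`, `H_X(x) = {A ∈ S(X) : x ∈ A}`. -/
def H (x : X) : IrrFilter 𝕏.S := ⟨{U | x ∈ U.1}, 𝕏.isIrreducibleFilter_point x⟩

/-- `T` is a meet-relation on the S-space, that is, `⟨X, K, T⟩` is an MoS-space. -/
structure IsMoS (T : Set (X × X)) : Prop where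
  box_mem : ∀ U ∈ subbasicClosed 𝕏.K, box T U ∈ subbasicClosed 𝕏.K
  sect_eq : ∀ x : X, sect T x = ⋂₀ {U | U ∈ subbasicClosed 𝕏.K ∧ sect T x ⊆ U}

/-- `⟨X, K, R⟩` is an mS-space. The intersection in (m2) is taken inside `Z(X)`. -/
structure IsMS (R : Set (X × Set X)) : Prop where
  sect_subset : ∀ x : X, sect R x ⊆ saturated 𝕏.K
  mSet_mem : ∀ U ∈ subbasicClosed 𝕏.K, mSet 𝕏.K R U ∈ subbasicClosed 𝕏.K
  sect_eq : ∀ x : X, sect R x =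
    {Z | Z ∈ saturated 𝕏.K ∧ ∀ U ∈ subbasicClosed 𝕏.K, x ∈ mSet 𝕏.K R U → Z ∈ meets 𝕏.K U}

/-- `⟨X, K, R⟩` is a normal mS-space. -/
structure IsNormalMS (R : Set (X × Set X)) : Prop extends 𝕏.IsMS R where
  exists_down : ∀ x : X, ∀ Z ∈ saturated 𝕏.K, Z ∈ sect R x → ∃ z ∈ Z, down 𝕏.K z ∈ sect R x
  empty_notMem : ∀ x : X, ∅ ∉ sect R x

variable {𝕏}

/-- The operator `□_T : S(X) → S(X)` of an MoS-space. -/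
def IsMoS.boxOp {T : Set (X × X)} (hT : 𝕏.IsMoS T) (U : 𝕏.S) : 𝕏.S :=
  ⟨box T U.1, hT.box_mem U.1 U.2⟩

/-- The operator `m_R : S(X) → S(X)` of an mS-space. -/
def IsMS.mOp {R : Set (X × Set X)} (hR : 𝕏.IsMS R) (U : 𝕏.S) : 𝕏.S :=
  ⟨mSet 𝕏.K R U.1, hR.mSet_mem U.1 U.2⟩

/-- The multirelation `R_T ⊆ X × Z(X)` of an MoS-space:
`(x, Z) ∈ R_T ↔ (H_X(x), H_X[Z]) ∈ R_{□_T}`. -/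
def IsMoS.multiRel {T : Set (X × X)} (hT : 𝕏.IsMoS T) : Set (X × Set X) :=
  {p | p.2 ∈ saturated 𝕏.K ∧ (𝕏.H p.1, 𝕏.H '' p.2) ∈ multiRelOfMap hT.boxOp}

/-- The relation `T_R ⊆ X × X` of an mS-space: `(x, y) ∈ T_R ↔ (H_X(x), H_X(y)) ∈ N_{m_R}`. -/
def IsMS.rel {R : Set (X × Set X)} (hR : 𝕏.IsMS R) : Set (X × X) :=
  {p | (𝕏.H p.1, 𝕏.H p.2) ∈ relOfMap hR.mOp}

end SSpace

end MoS

namespace MoS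

section Filters

variable {A : Type u} [SemilatticeInf A] [OrderTop A]

/-! Both relations are recovered from their operators. For closed `T(x)`, `y ∈ T(x)` iff `y` lies in
every `U ∈ S(X)` with `x ∈ □_T(U)`; and `Z ∈ R(x)` iff `Z` is saturated and meets every `U ∈ S(X)`
with `x ∈ m_R(U)`. Since `T_R` and `R_T` are given by these same conditions, everything reduces to
two equalities of operators: `mSet_multiRel` and `box_rel`. The first tests `R_T` on members of the
subbase; the second is where normality enters.

The S-space axioms serve twice, through (S4): every irreducible filter of `S(X)` comes from a point
(`H_surjective`), so `H_X[Z]` is saturated; and members of `R_T(x)` meet `T(x)`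
(`inter_sect_nonempty`), which gives normality of `R_T`. -/

/-- The filter generated by a filter together with one more element. -/
theorem IsSemilatticeFilter.adjoin {F : Set A} (hF : IsSemilatticeFilter F) (a : A) :
    IsSemilatticeFilter {c | ∃ h ∈ F, a ⊓ h ≤ c} where
  upper := fun _ _ hbc ⟨h, hh, hle⟩ => ⟨h, hh, hle.trans hbc⟩
  top_mem := ⟨⊤, hF.top_mem, le_top⟩
  inf_mem := fun _ _ ⟨h, hh, hle⟩ ⟨k, hk, kle⟩ =>
    ⟨h ⊓ k, hF.inf_mem _ _ hh hk,
      le_inf ((inf_le_inf_left a inf_le_left).trans hle)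
        ((inf_le_inf_left a inf_le_right).trans kle)⟩

/-- Elements outside an irreducible filter are bounded, relative to some member of the filter,
by an element outside the filter. -/
theorem IsIrreducibleFilter.exists_notMem_of_notMem {F : Set A} (hF : IsIrreducibleFilter F)
    {a b : A} (ha : a ∉ F) (hb : b ∉ F) : ∃ h ∈ F, ∃ c ∉ F, a ⊓ h ≤ c ∧ b ⊓ h ≤ c := by
  have hf := hF.isFilter
  by_contra! hcon
  -- Without such `c`, `F` is the intersection of its extensions by `a` and by `b`, so
  -- irreducibility puts `a` or `b` in `F`.
  have heq : F = {c | ∃ h ∈ F, a ⊓ h ≤ c} ∩ {c | ∃ h ∈ F, b ⊓ h ≤ c} := by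
    refine Set.Subset.antisymm (fun c hc => ⟨⟨c, hc, inf_le_right⟩, ⟨c, hc, inf_le_right⟩⟩) ?_
    rintro c ⟨⟨h, hh, hle⟩, ⟨k, hk, kle⟩⟩
    by_contra hc
    exact hcon (h ⊓ k) (hf.inf_mem _ _ hh hk) c hc
      ((inf_le_inf_left a inf_le_left).trans hle) ((inf_le_inf_left b inf_le_right).trans kle)
  rcases hF.irreducible _ _ (hf.adjoin a) (hf.adjoin b) heq with h | h
  · exact ha (h ▸ ⟨⊤, hf.top_mem, inf_le_left⟩)
  · exact hb (h ▸ ⟨⊤, hf.top_mem, inf_le_left⟩)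

end Filters

section Subbase

variable {X : Type u} {K : Set (Set X)}

theorem mem_down_self (x : X) : x ∈ down K x := fun _ hU => hU.2 rfl

theorem mem_of_mem_down {x y : X} (h : y ∈ down K x) {U : Set X} (hU : U ∈ subbasicClosed K)
    (hy : y ∈ U) : x ∈ U :=
  h U ⟨hU, Set.singleton_subset_iff.2 hy⟩

theorem mem_saturated_of_mem {U : Set X} (hU : U ∈ K) : U ∈ saturated K :=
  ⟨{U}, Set.singleton_subset_iff.2 hU, Set.singleton_nonempty U, directedOn_singleton U,
    Set.sInter_singleton U |>.symm⟩

end Subbase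

namespace SSpace

variable {X : Type u} (𝕏 : SSpace X)

/-! ### Points and irreducible filters of `S(X)` -/

/-- A filter of `S(X)` contains every member of `S(X)` that includes its intersection. -/
theorem mem_of_sInter_subset {F : Set 𝕏.S} (hF : IsSemilatticeFilter F) (A : 𝕏.S)
    (h : ⋂ U ∈ F, U.1 ⊆ A.1) : A ∈ F := by
  let _ : TopologicalSpace X := TopologicalSpace.generateFrom 𝕏.K
  -- The complements of the members of `F` form a directed open cover of the compact set `Aᶜ`, so a
  -- single one covers it.
  obtain ⟨⟨U, hU⟩, hUA⟩ := (𝕏.compact _ A.2).elim_directed_cover (fun U : F => U.1.1ᶜ)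
    (hι := ⟨⟨⊤, hF.top_mem⟩⟩)
    (fun U => TopologicalSpace.isOpen_generateFrom_of_mem U.1.2)
    (fun x hx => by
      by_contra hc
      simp only [Set.mem_iUnion, not_exists, Set.mem_compl_iff, not_not] at hc
      exact hx (h (Set.mem_iInter₂.2 fun U hU => hc ⟨U, hU⟩)))
    (fun U V => ⟨⟨U.1 ⊓ V.1, hF.inf_mem _ _ U.2 V.2⟩,
      Set.compl_subset_compl.2 (inf_le_left : U.1 ⊓ V.1 ≤ U.1),
      Set.compl_subset_compl.2 (inf_le_right : U.1 ⊓ V.1 ≤ V.1)⟩)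
  exact hF.upper _ _ (Set.compl_subset_compl.1 hUA) hU

/-- Every irreducible filter of `S(X)` is the filter of a point. -/
theorem H_surjective : Function.Surjective 𝕏.H := by
  intro P
  have hP := P.2.isFilter
  have hne : ∃ A : 𝕏.S, A ∉ P.1 := (Set.ne_univ_iff_exists_notMem _).1 P.2.proper
  -- (S4) with `Y = ⋂ P` and `J` the complement of `P`: irreducibility makes `J` a `Y`-family, and a
  -- point of `Y` outside all members of `J` has filter exactly `P`.
  obtain ⟨x, hxY, hxJ⟩ := 𝕏.family (⋂₀ (Subtype.val '' P.1))
    ⟨Subtype.val '' P.1, by rintro _ ⟨U, -, rfl⟩; exact U.2, rfl⟩ (Subtype.val '' P.1ᶜ)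
    (Set.Nonempty.image _ hne)
    ⟨by rintro _ ⟨U, -, rfl⟩; exact U.2, by
      rintro _ ⟨A, hA, rfl⟩ _ ⟨B, hB, rfl⟩
      obtain ⟨h, hh, c, hc, hac, hbc⟩ := P.2.exists_notMem_of_notMem hA hB
      exact ⟨h.1, h.2, c.1, ⟨c, hc, rfl⟩, Set.sInter_subset_of_mem ⟨h, hh, rfl⟩, hac, hbc⟩⟩
    (by
      rintro _ ⟨A, hA, rfl⟩
      by_contra hcon
      refine hA (𝕏.mem_of_sInter_subset hP A fun x hx => ?_)
      by_contra hxA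
      refine hcon ⟨x, ?_, hxA⟩
      rintro _ ⟨U, hU, rfl⟩
      exact Set.mem_iInter₂.1 hx U hU)
  refine ⟨x, Subtype.ext (Set.Subset.antisymm (fun A hA => ?_) fun A hA => hxY _ ⟨A, hA, rfl⟩)⟩
  by_contra hAP
  exact Set.mem_iInter₂.1 hxJ A.1 ⟨A, hAP, rfl⟩ hA

/-- `H_X` maps subbasic saturated sets to subbasic saturated sets. -/
theorem image_H_mem_saturated {Z : Set X} (hZ : Z ∈ saturated 𝕏.K) :
    𝕏.H '' Z ∈ saturated (specSubbase 𝕏.S) := by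
  obtain ⟨L, hLK, ⟨U₀, hU₀⟩, hdir, rfl⟩ := hZ
  have hcompl : ∀ U ∈ L, Uᶜ ∈ subbasicClosed 𝕏.K := fun U hU => by
    simpa [subbasicClosed] using hLK hU
  refine ⟨{V | ∃ a : 𝕏.S, a.1ᶜ ∈ L ∧ V = (beta a)ᶜ}, ?_, ?_, ?_, ?_⟩
  · rintro _ ⟨a, -, rfl⟩
    exact ⟨a, rfl⟩
  · exact ⟨_, ⟨U₀ᶜ, hcompl U₀ hU₀⟩, by simpa using hU₀, rfl⟩
  · rintro _ ⟨a, ha, rfl⟩ _ ⟨b, hb, rfl⟩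
    obtain ⟨W, hW, haW, hbW⟩ := hdir _ ha _ hb
    let c : 𝕏.S := ⟨Wᶜ, hcompl W hW⟩
    have hac : a ≤ c := Set.subset_compl_comm.1 haW
    have hbc : b ≤ c := Set.subset_compl_comm.1 hbW
    exact ⟨(beta c)ᶜ, ⟨c, by simpa [c] using hW, rfl⟩,
      Set.compl_subset_compl.2 fun P hP => P.2.isFilter.upper _ _ hac hP,
      Set.compl_subset_compl.2 fun P hP => P.2.isFilter.upper _ _ hbc hP⟩
  · ext P
    -- Surjectivity is needed because the intersection ranges over all irreducible filters, not only
    -- those of points.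
    obtain ⟨x, rfl⟩ := 𝕏.H_surjective P
    constructor
    · rintro ⟨y, hy, hyx⟩ _ ⟨a, ha, rfl⟩
      rw [← hyx]
      exact hy _ ha
    · intro h
      refine ⟨x, fun U hU => ?_, rfl⟩
      by_contra hxU
      exact h _ ⟨⟨Uᶜ, hcompl U hU⟩, by simpa using hU, rfl⟩ hxU

/-! ### From meet-relations to multirelations -/

variable {𝕏}

/-- `U` lies outside the ideal of `H_X[Z]` exactly when `Z` meets `U`, and saturation of `H_X[Z]` is
automatic. -/
theorem IsMoS.mem_multiRel {T : Set (X × X)} (hT : 𝕏.IsMoS T) {x : X} {Z : Set X} :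
    Z ∈ sect hT.multiRel x ↔ Z ∈ saturated 𝕏.K ∧
      ∀ U ∈ subbasicClosed 𝕏.K, x ∈ box T U → (Z ∩ U).Nonempty := by
  constructor
  · rintro ⟨hZ, -, h⟩
    refine ⟨hZ, fun U hU hx => ?_⟩
    by_contra hc
    refine (Set.eq_empty_iff_forall_notMem.1 h ⟨U, hU⟩) ⟨hx, ?_⟩
    refine Set.eq_empty_iff_forall_notMem.2 ?_
    rintro _ ⟨hP, z, hz, rfl⟩
    exact hc ⟨z, hz, hP⟩
  · rintro ⟨hZ, h⟩
    refine ⟨hZ, 𝕏.image_H_mem_saturated hZ, Set.eq_empty_iff_forall_notMem.2 ?_⟩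
    rintro U ⟨hx, hU⟩
    obtain ⟨z, hz, hzU⟩ := h U.1 U.2 hx
    exact Set.eq_empty_iff_forall_notMem.1 hU (𝕏.H z) ⟨hzU, z, hz, rfl⟩

theorem IsMoS.mSet_multiRel {T : Set (X × X)} (hT : 𝕏.IsMoS T) {U : Set X}
    (hU : U ∈ subbasicClosed 𝕏.K) : mSet 𝕏.K hT.multiRel U = box T U := by
  ext x
  constructor
  · intro hx
    by_contra hc
    -- If `T(x) ⊄ U`, then `Uᶜ` is a saturated set in `R_T(x)` that misses `U`.
    have hmem : Uᶜ ∈ sect hT.multiRel x := by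
      refine hT.mem_multiRel.2 ⟨mem_saturated_of_mem hU, fun V _ hxV => ?_⟩
      rw [Set.inter_comm, Set.inter_compl_nonempty_iff]
      exact fun hVU => hc (Set.Subset.trans hxV hVU)
    simpa using (hx hmem).2
  · intro hx Z hZ
    have h := hT.mem_multiRel.1 hZ
    exact ⟨h.1, h.2 U hU hx⟩

theorem IsMoS.isMS {T : Set (X × X)} (hT : 𝕏.IsMoS T) : 𝕏.IsMS hT.multiRel where
  sect_subset _ _ hZ := hZ.1
  mSet_mem U hU := hT.mSet_multiRel hU ▸ hT.box_mem U hU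
  sect_eq x := by
    ext Z
    refine ⟨fun hZ => ⟨hZ.1, fun U _ hx => hx hZ⟩, fun ⟨hZ, h⟩ => hT.mem_multiRel.2
      ⟨hZ, fun U hU hx => (h U hU ?_).2⟩⟩
    rwa [hT.mSet_multiRel hU]

/-- In an MoS-space, every member of `R_T(x)` meets `T(x)`. -/
theorem IsMoS.inter_sect_nonempty {T : Set (X × X)} (hT : 𝕏.IsMoS T) {x : X} {Z : Set X}
    (hZ : Z ∈ sect hT.multiRel x) : (Z ∩ sect T x).Nonempty := by
  obtain ⟨⟨L, hLK, hL, hdir, rfl⟩, h⟩ := hT.mem_multiRel.1 hZ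
  -- (S4) with `Y = T(x)` and the complements of `L`; by directedness of `L`, `H = X` suffices. If
  -- `T(x)` missed some `U ∈ L`, then `Z` would meet `Uᶜ` although `Z ⊆ U`.
  obtain ⟨z, hzT, hz⟩ := 𝕏.family (sect T x) ⟨_, fun _ hU => hU.1, hT.sect_eq x⟩
    (compl '' L) (hL.image _)
    ⟨by rintro _ ⟨U, hU, rfl⟩; simpa [subbasicClosed] using hLK hU, by
      rintro _ ⟨U, hU, rfl⟩ _ ⟨V, hV, rfl⟩
      obtain ⟨W, hW, hUW, hVW⟩ := hdir U hU V hV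
      exact ⟨Set.univ, by simpa [subbasicClosed] using 𝕏.empty_mem, Wᶜ, ⟨W, hW, rfl⟩,
        Set.subset_univ _, Set.inter_subset_left.trans (Set.compl_subset_compl.2 hUW),
        Set.inter_subset_left.trans (Set.compl_subset_compl.2 hVW)⟩⟩
    (by
      rintro _ ⟨U, hU, rfl⟩
      rw [Set.inter_compl_nonempty_iff]
      intro hsub
      obtain ⟨z, hz, hzU⟩ := h Uᶜ (by simpa [subbasicClosed] using hLK hU) hsub
      exact hzU (hz U hU))
  refine ⟨z, fun U hU => ?_, hzT⟩
  simpa using Set.mem_iInter₂.1 hz Uᶜ ⟨U, hU, rfl⟩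

theorem IsMoS.isNormalMS {T : Set (X × X)} (hT : 𝕏.IsMoS T)
    (hdown : ∀ x : X, down 𝕏.K x ∈ saturated 𝕏.K) : 𝕏.IsNormalMS hT.multiRel where
  toIsMS := hT.isMS
  exists_down x Z _ hZ := by
    obtain ⟨z, hz, hzT⟩ := hT.inter_sect_nonempty hZ
    exact ⟨z, hz, hT.mem_multiRel.2 ⟨hdown z, fun U _ hx => ⟨z, mem_down_self z, hx hzT⟩⟩⟩
  empty_notMem x hx := by simpa using hT.inter_sect_nonempty hx

/-! ### Recovering each relation from the other -/

theorem IsMS.mem_rel {R : Set (X × Set X)} (hR : 𝕏.IsMS R) {x y : X} :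
    (x, y) ∈ hR.rel ↔ ∀ U ∈ subbasicClosed 𝕏.K, x ∈ mSet 𝕏.K R U → y ∈ U :=
  ⟨fun h U hU hx => h (show (⟨U, hU⟩ : 𝕏.S) ∈ hR.mOp ⁻¹' (𝕏.H x).1 from hx),
    fun h U hx => h U.1 U.2 hx⟩

theorem IsMoS.rel_multiRel {T : Set (X × X)} (hT : 𝕏.IsMoS T) : T = hT.isMS.rel := by
  ext ⟨x, y⟩
  rw [hT.isMS.mem_rel]
  change y ∈ sect T x ↔ _
  rw [hT.sect_eq x]
  refine ⟨fun h U hU hx => h U ⟨hU, ?_⟩, fun h U hU => h U hU.1 ?_⟩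
  · rwa [hT.mSet_multiRel hU] at hx
  · rw [hT.mSet_multiRel hU.1]
    exact hU.2

/-- Normality gives `z ∈ Z` with `(z] ∈ R(x)`. If `x ∈ m_R(V)`, then `(z]` meets `V`, hence `z ∈ V`;
so `z ∈ T_R(x)`, and `Z` meets every `U ⊇ T_R(x)`. -/
theorem IsNormalMS.box_rel {R : Set (X × Set X)} (hR : 𝕏.IsNormalMS R) {U : Set X}
    (hU : U ∈ subbasicClosed 𝕏.K) : box hR.toIsMS.rel U = mSet 𝕏.K R U := by
  ext x
  refine ⟨fun hx Z hZ => ?_, fun hx y hy => hR.toIsMS.mem_rel.1 hy U hU hx⟩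
  have hZs := hR.sect_subset x hZ
  obtain ⟨z, hz, hzR⟩ := hR.exists_down x Z hZs hZ
  refine ⟨hZs, z, hz, hx (hR.toIsMS.mem_rel.2 fun V hV hxV => ?_)⟩
  obtain ⟨w, hw, hwV⟩ := (hxV hzR).2
  exact mem_of_mem_down hw hV hwV

theorem IsNormalMS.isMoS {R : Set (X × Set X)} (hR : 𝕏.IsNormalMS R) :
    𝕏.IsMoS hR.toIsMS.rel where
  box_mem U hU := hR.box_rel hU ▸ hR.mSet_mem U hU
  sect_eq x := by
    refine Set.Subset.antisymm (fun y hy U hU => hU.2 hy) fun y hy => ?_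
    refine hR.toIsMS.mem_rel.2 fun U hU hx => hy U ⟨hU, ?_⟩
    rwa [← hR.box_rel hU] at hx

theorem IsNormalMS.multiRel_rel {R : Set (X × Set X)} (hR : 𝕏.IsNormalMS R) :
    R = hR.isMoS.multiRel := by
  ext ⟨x, Z⟩
  change Z ∈ sect R x ↔ Z ∈ sect hR.isMoS.multiRel x
  rw [hR.isMoS.mem_multiRel, hR.sect_eq x]
  refine and_congr_right fun hZ => forall₂_congr fun U hU => ?_
  rw [hR.box_rel hU]
  exact imp_congr_right fun _ => ⟨fun h => h.2, fun h => ⟨hZ, h⟩⟩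

end SSpace

end MoS

theorem mainTheorem6 {X : Type u} (𝕏 : MoS.SSpace X) :
    (∀ (T : Set (X × X)) (hT : 𝕏.IsMoS T),
      (∃ hR : 𝕏.IsMS hT.multiRel, T = hR.rel ∧ hR.mOp = hT.boxOp) ∧
      ((∀ x : X, MoS.down 𝕏.K x ∈ MoS.saturated 𝕏.K) → 𝕏.IsNormalMS hT.multiRel)) ∧
    (∀ (R : Set (X × Set X)) (hR : 𝕏.IsNormalMS R),
      ∃ hT : 𝕏.IsMoS hR.toIsMS.rel, R = hT.multiRel ∧ hR.toIsMS.mOp = hT.boxOp) :=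
  ⟨fun _ hT => ⟨⟨hT.isMS, hT.rel_multiRel,
      funext fun U => Subtype.ext (hT.mSet_multiRel U.2)⟩, hT.isNormalMS⟩,
    fun _ hR => ⟨hR.isMoS, hR.multiRel_rel,
      funext fun U => Subtype.ext (hR.box_rel U.2).symm⟩⟩
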